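/- Let $1<p,q<\infty$, let $(\Omega,\mu)$ and $(\Omega',\nu)$ be measure spaces, let $L_q=L_q(\Omega',\nu)$ be the real Lebesgue space and let $X=L_p(L_q)=L_p(\Omega,\mu;L_q(\Omega',\nu))$ be the Lebesgue–Bochner space with its norm $\|u\|=\left(\int_\Omega \|u(s)\|_{L_q}^p\,d\mu(s)\right)^{1/p}$. For a real number $s>1$, let $n$ be the largest integer strictly less than $s$; the norm of $X$ is called uniformly $H^s$-smooth if it is $n$ times continuously Fréchet differentiable on $X\setminus\{0\}$ and its $n$-th derivative is $(s-n)$-Hölder on the unit sphere $S_X$, that is, there is $M>0$ such that, with $N(x)=\|x\|$, $\|N^{(n)}(x)-N^{(n)}(y)\|\le M\|x-y\|^{s-n}$ for all $x,y\in S_X$. Put $r=\min\{p,q\}$. Then: (1) If $r$ is not an even integer, or if $r=p$ is an even integer, then the norm of $X$ is uniformly $H^r$-smooth. (2) If $r=q$ is an even integer, then the norm of $X$ is uniformly $H^p$-smooth. If moreover $p$ is an integer multiple of $q$, then the norm of $X$ is $C^\infty$ on $X\setminus\{0\}$. -/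

import Mathlib

open MeasureTheory
open scoped ENNReal ContDiff

/-- The largest integer strictly less than `r`, for a real number `r > 0`
(see `isGreatest_largestNatBelow`). -/
noncomputable def largestNatBelow (r : ℝ) : ℕ := ⌈r⌉₊ - 1

theorem isGreatest_largestNatBelow {r : ℝ} (hr : 0 < r) :
    IsGreatest {m : ℤ | (m : ℝ) < r} (largestNatBelow r : ℤ) := by
  have hpos : 0 < ⌈r⌉₊ := Nat.ceil_pos.mpr hr
  constructor
  · have h : largestNatBelow r < ⌈r⌉₊ := Nat.sub_lt hpos one_pos
    have h' := Nat.lt_ceil.mp h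
    simpa using h'
  · intro m hm
    have h1 : (m : ℝ) < (⌈r⌉₊ : ℝ) := lt_of_lt_of_le hm (Nat.le_ceil r)
    have h2 : m < (⌈r⌉₊ : ℤ) := by exact_mod_cast h1
    unfold largestNatBelow
    omega

/-- The real number `x` is an even integer. -/
def IsEvenInteger (x : ℝ) : Prop := ∃ k : ℤ, Even k ∧ x = (k : ℝ)

/-- The norm of the real normed space `E` is uniformly `H^r`-smooth: with `n` the largest integer
strictly less than `r`, it is `C^n` on `E ∖ {0}`, and its `n`-th Fréchet derivative is
`(r - n)`-Hölder on the unit sphere. -/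
def UniformlyHSmoothNorm (E : Type*) [NormedAddCommGroup E] [NormedSpace ℝ E] (r : ℝ) : Prop :=
  ContDiffOn ℝ (largestNatBelow r) (fun x : E => ‖x‖) {0}ᶜ ∧
    ∃ M : ℝ, 0 < M ∧ ∀ x ∈ Metric.sphere (0 : E) 1, ∀ y ∈ Metric.sphere (0 : E) 1,
      ‖iteratedFDeriv ℝ (largestNatBelow r) (fun x : E => ‖x‖) x -
          iteratedFDeriv ℝ (largestNatBelow r) (fun x : E => ‖x‖) y‖ ≤
        M * ‖x - y‖ ^ (r - (largestNatBelow r : ℝ))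

/-- The norm of the real normed space `E` is `C^∞`-smooth, that is, `C^∞` on `E ∖ {0}`. -/
def SmoothNorm (E : Type*) [NormedAddCommGroup E] [NormedSpace ℝ E] : Prop :=
  ContDiffOn ℝ ∞ (fun x : E => ‖x‖) {0}ᶜ

open Set Filter

/-! The proof works with powers of the norm. Write the target smoothness as `n + α`. The property
`HolderNormPow E p n α` records derivatives of `‖x‖ ^ p` with weighted bounds whose total degree
matches homogeneity. Such bounds integrate: in `L_p(E)` one has `‖u‖ ^ p = ∫ ‖u s‖ ^ p`, its
derivatives are integrals of the pointwise ones, and Hölder's inequality with exponents summing to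
one turns each pointwise bound into the same bound for `u`. This is `HolderNormPow.lp`.

The outer and inner exponents differ, so the power must be changed in between. Off the origin this
is composition with `t ^ (p / q)`, harmless on an annulus (`HolderSmoothOffZero.norm_rpow`).
Homogeneity then carries the annulus estimate to the whole space, provided `n + α ≤ p`
(`HolderSmoothOffZero.holderNormPow`). Starting from the polynomial `x ^ 2` on `ℝ`, one climbs to
`L_q`, switches exponent and climbs to `L_p(L_q)`; each climb costs `n + α ≤ q` or `n + α ≤ p`,
whence `min p q`.

If `q` is an even integer, `‖x‖ ^ q` is a polynomial on `L_q` (`PolynomialNormPow.lp`), so the inner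
climb imposes no limit and only `p` remains. If also `p` is a multiple of `q`, then `‖u‖ ^ p` is
itself a polynomial on `L_p(L_q)`. -/

/-- `g` is bounded and `α`-Hölder on `S`. -/
def BoundedHolderOn {E F : Type*} [NormedAddCommGroup E] [NormedAddCommGroup F] (α : ℝ)
    (S : Set E) (g : E → F) : Prop :=
  ∃ C : ℝ, 0 ≤ C ∧ (∀ x ∈ S, ‖g x‖ ≤ C) ∧ ∀ x ∈ S, ∀ y ∈ S, ‖g x - g y‖ ≤ C * ‖x - y‖ ^ α

/-- The closed annulus of radii `1 / 2` and `1`. -/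
def halfAnnulus (E : Type*) [NormedAddCommGroup E] : Set E := {x | 1 / 2 ≤ ‖x‖ ∧ ‖x‖ ≤ 1}

/-- `f` is `C^n` off the origin, with derivatives bounded and `α`-Hölder on the annulus. -/
def HolderSmoothOffZero {E : Type*} [NormedAddCommGroup E] [NormedSpace ℝ E] (n : ℕ) (α : ℝ)
    (f : E → ℝ) : Prop :=
  ∃ T : E → FormalMultilinearSeries ℝ E ℝ, HasFTaylorSeriesUpToOn n f T {0}ᶜ ∧
    ∀ k ≤ n, BoundedHolderOn α (halfAnnulus E) (fun x => T x k)

/-- The function `‖x‖ ^ p` is `C^n` with derivatives of the growth expected from homogeneity, the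
`n`-th one being `α`-Hölder with the weight expected from homogeneity. -/
def HolderNormPow (E : Type*) [NormedAddCommGroup E] [NormedSpace ℝ E] (p : ℝ) (n : ℕ) (α : ℝ) :
    Prop :=
  ∃ T : E → FormalMultilinearSeries ℝ E ℝ, HasFTaylorSeriesUpTo n (fun x : E => ‖x‖ ^ p) T ∧
    ∃ C : ℝ, 0 ≤ C ∧ (∀ k ≤ n, ∀ x, ‖T x k‖ ≤ C * ‖x‖ ^ (p - k)) ∧
      ∀ x y, ‖T x n - T y n‖ ≤ C * ‖x - y‖ ^ α * (‖x‖ + ‖y‖) ^ (p - n - α)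

/-- The function `‖x‖ ^ m` is a continuous homogeneous polynomial of degree `m`. -/
def PolynomialNormPow (E : Type*) [NormedAddCommGroup E] [NormedSpace ℝ E] (m : ℕ) : Prop :=
  ∃ B : ContinuousMultilinearMap ℝ (fun _ : Fin m => E) ℝ, ∀ x, B (fun _ => x) = ‖x‖ ^ m

/-! ### Estimates on the annulus and change of exponent -/

section

variable {E F : Type*} [NormedAddCommGroup E] [NormedSpace ℝ E] [NormedAddCommGroup F]
  [NormedSpace ℝ F]

theorem le_two_mul_rpow {d α : ℝ} (hd : 0 ≤ d) (hd2 : d ≤ 2) (hα : 0 < α) (hα1 : α ≤ 1) :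
    d ≤ 2 * d ^ α := by
  rcases hd.eq_or_lt with rfl | h
  · simp [hα.ne']
  · calc d = d ^ (1 - α) * d ^ α := by rw [← Real.rpow_add h]; simp
      _ ≤ 2 * d ^ α := by
        gcongr
        calc d ^ (1 - α) ≤ 2 ^ (1 - α) := by gcongr
          _ ≤ 2 ^ (1 : ℝ) := by gcongr <;> linarith
          _ = 2 := by simp

theorem norm_sub_le_two_mul_rpow {E : Type*} [NormedAddCommGroup E] {x y : E} {α : ℝ}
    (hx : ‖x‖ ≤ 1) (hy : ‖y‖ ≤ 1) (hα : 0 < α) (hα1 : α ≤ 1) : ‖x - y‖ ≤ 2 * ‖x - y‖ ^ α :=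
  le_two_mul_rpow (norm_nonneg _) ((norm_sub_le x y).trans (by linarith)) hα hα1

/-- A Taylor series term is Lipschitz on a convex set where the next one is bounded. -/
theorem HasFTaylorSeriesUpToOn.norm_sub_le {n : ℕ} {f : E → F}
    {T : E → FormalMultilinearSeries ℝ E F} {s t : Set E} (h : HasFTaylorSeriesUpToOn n f T s)
    (hts : t ⊆ s) (ht : Convex ℝ t) {k : ℕ} (hk : k < n) {C : ℝ}
    (hC : ∀ x ∈ t, ‖T x (k + 1)‖ ≤ C) {x y : E} (hx : x ∈ t) (hy : y ∈ t) :
    ‖T x k - T y k‖ ≤ C * ‖x - y‖ :=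
  ht.norm_image_sub_le_of_norm_hasFDerivWithin_le (f := fun x => T x k)
    (fun z hz => (h.fderivWithin k (by exact_mod_cast hk) z (hts hz)).mono hts)
    (fun z hz => by simpa using hC z hz) hy hx

theorem HasFTaylorSeriesUpTo.norm_sub_le {n : ℕ} {f : E → F}
    {T : E → FormalMultilinearSeries ℝ E F} (h : HasFTaylorSeriesUpTo n f T) {k : ℕ} (hk : k < n)
    {p C : ℝ} (hp : (n : ℝ) ≤ p) (hC0 : 0 ≤ C) (hC : ∀ x, ‖T x (k + 1)‖ ≤ C * ‖x‖ ^ (p - (k + 1)))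
    {R : ℝ} {x y : E} (hx : ‖x‖ ≤ R) (hy : ‖y‖ ≤ R) :
    ‖T x k - T y k‖ ≤ C * R ^ (p - (k + 1)) * ‖x - y‖ := by
  have hk' : (k : ℝ) + 1 ≤ n := by exact_mod_cast hk
  refine (h.hasFTaylorSeriesUpToOn univ).norm_sub_le (subset_univ (Metric.closedBall 0 R))
    (convex_closedBall _ _) hk (fun z hz => (hC z).trans ?_) (by simpa using hx) (by simpa using hy)
  have : ‖z‖ ≤ R := by simpa using hz
  gcongr
  linarith

theorem HolderSmoothOffZero.congr {n : ℕ} {α : ℝ} {f g : E → ℝ} (h : HolderSmoothOffZero n α f)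
    (hfg : ∀ x, x ≠ 0 → g x = f x) : HolderSmoothOffZero n α g := by
  obtain ⟨T, hT, hb⟩ := h
  exact ⟨T, hT.congr fun x hx => hfg x hx, hb⟩

/-- By the Faà di Bruno formula, the derivatives of the composite are sums of products of bounded
Hölder terms. Compactness of `[a, b]` bounds the derivatives of `g`, and convexity of `[a, b]` makes
them Lipschitz there. -/
theorem HolderSmoothOffZero.comp {n : ℕ} {α : ℝ} {f : E → ℝ} (h : HolderSmoothOffZero n α f)
    {g : ℝ → ℝ} (hg : ContDiffOn ℝ ∞ g (Ioi 0)) (hf : ∀ x, x ≠ 0 → 0 < f x) {a b : ℝ} (ha : 0 < a)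
    (hab : ∀ x ∈ halfAnnulus E, f x ∈ Icc a b) : HolderSmoothOffZero n α (g ∘ f) := by
  obtain ⟨T, hT, hb⟩ := h
  have hsub : Icc a b ⊆ Ioi 0 := fun t ht => ha.trans_le ht.1
  have hne : ∀ x ∈ halfAnnulus E, x ≠ 0 := by
    rintro x hx rfl
    have := hx.1
    norm_num at this
  -- One derivative of `g` beyond `n`: it supplies the Lipschitz constant of the `n`-th.
  have hq := (hg.of_le (m := ((n + 1 : ℕ) : WithTop ℕ∞))
    (by exact_mod_cast le_top)).ftaylorSeriesWithin (uniqueDiffOn_Ioi 0)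
  set Q := ftaylorSeriesWithin ℝ g (Ioi 0)
  have hQb : ∀ k ≤ n + 1, ∃ C, ∀ t ∈ Icc a b, ‖Q t k‖ ≤ C := fun k hk =>
    isCompact_Icc.exists_bound_of_continuousOn ((hq.cont k (by exact_mod_cast hk)).mono hsub)
  obtain ⟨Cf, hCf0, -, hCf⟩ := hb 0 (Nat.zero_le _)
  have hfH : ∀ x ∈ halfAnnulus E, ∀ y ∈ halfAnnulus E, ‖f x - f y‖ ≤ Cf * ‖x - y‖ ^ α := by
    intro x hx y hy
    rw [← hT.zero_eq x (hne x hx), ← hT.zero_eq y (hne y hy)]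
    refine le_trans (le_of_eq ?_) (hCf x hx y hy)
    exact (continuousMultilinearCurryFin0 ℝ E ℝ).norm_map (T x 0 - T y 0)
  refine ⟨_, (hq.of_le (by exact_mod_cast n.le_succ)).comp hT fun x hx => hf x hx, fun k hk => ?_⟩
  -- Over a principal filter, `O` is a uniform bound on all pairs of points of the annulus.
  have hO := FormalMultilinearSeries.taylorComp_sub_taylorComp_isBigO
    (l := 𝓟 (halfAnnulus E ×ˢ halfAnnulus E)) (f := fun z : E × E => ‖z.1 - z.2‖ ^ α)
    (p₁ := fun z : E × E => Q (f z.1)) (p₂ := fun z => Q (f z.2))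
    (q₁ := fun z : E × E => T z.1) (q₂ := fun z => T z.2) (n := k) ?_ ?_ ?_ ?_ ?_
  · have hB : ∃ C, ∀ x ∈ halfAnnulus E, ‖(Q (f x)).taylorComp (T x) k‖ ≤ C := by
      choose! CQ hCQ using hQb
      choose! CT hCT0 hCT _ using hb
      refine ⟨∑ c : OrderedFinpartition k, CQ c.length * ∏ i, CT (c.partSize i), fun x hx => ?_⟩
      refine (norm_sum_le _ _).trans (Finset.sum_le_sum fun c _ =>
        (c.norm_compAlongOrderedFinpartition_le _ _).trans ?_)
      have h1 := hCQ c.length (c.length_le.trans (hk.trans n.le_succ)) (f x) (hab x hx)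
      refine mul_le_mul h1 (Finset.prod_le_prod (fun _ _ => norm_nonneg _) fun i _ =>
        hCT _ ((c.partSize_le i).trans hk) x hx) (by positivity) ((norm_nonneg _).trans h1)
    obtain ⟨C₁, hC₁⟩ := hB
    obtain ⟨C₂, hC₂⟩ := Asymptotics.isBigO_principal.1 hO
    refine ⟨max (max C₁ C₂) 0, le_max_right _ _, fun x hx => (hC₁ x hx).trans
      ((le_max_left _ _).trans (le_max_left _ _)), fun x hx y hy => ?_⟩
    refine (hC₂ (x, y) ⟨hx, hy⟩).trans ?_
    rw [Real.norm_of_nonneg (Real.rpow_nonneg (norm_nonneg _) _)]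
    gcongr
    exact (le_max_right _ _).trans (le_max_left _ _)
  · intro j hj
    obtain ⟨C, hC⟩ := hQb j (hj.trans (hk.trans n.le_succ))
    exact isBoundedUnder_of_eventually_le (eventually_principal.2 fun z hz => hC _ (hab _ hz.1))
  · intro j hj
    obtain ⟨C, hC⟩ := hQb (j + 1) (Nat.succ_le_succ (hj.trans hk))
    refine Asymptotics.isBigO_principal.2 ⟨C * Cf, fun z hz => ?_⟩
    have hC0 : 0 ≤ C := (norm_nonneg _).trans (hC _ (hab z.1 hz.1))
    refine (hq.norm_sub_le hsub (convex_Icc a b) (by omega) hC (hab _ hz.1) (hab _ hz.2)).trans ?_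
    rw [Real.norm_of_nonneg (Real.rpow_nonneg (norm_nonneg (z.1 - z.2)) α), mul_assoc]
    gcongr
    exact hfH _ hz.1 _ hz.2
  · intro j hj
    obtain ⟨C, _, hC, _⟩ := hb j (hj.trans hk)
    exact isBoundedUnder_of_eventually_le (eventually_principal.2 fun z hz => hC _ hz.1)
  · intro j hj
    obtain ⟨C, _, hC, _⟩ := hb j (hj.trans hk)
    exact isBoundedUnder_of_eventually_le (eventually_principal.2 fun z hz => hC _ hz.2)
  · intro j hj
    obtain ⟨C, _, _, hC⟩ := hb j (hj.trans hk)
    refine Asymptotics.isBigO_principal.2 ⟨C, fun z hz => ?_⟩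
    rw [Real.norm_of_nonneg (Real.rpow_nonneg (norm_nonneg _) _)]
    exact hC _ hz.1 _ hz.2

theorem HolderSmoothOffZero.norm_rpow {n : ℕ} {α p : ℝ} (hp : 0 < p)
    (h : HolderSmoothOffZero n α fun x : E => ‖x‖ ^ p) (p' : ℝ) :
    HolderSmoothOffZero n α fun x : E => ‖x‖ ^ p' := by
  have hg : ContDiffOn ℝ ∞ (fun t : ℝ => t ^ (p' / p)) (Ioi 0) := fun t ht =>
    (Real.contDiffAt_rpow_const_of_ne (ne_of_gt ht)).contDiffWithinAt
  refine (h.comp hg (fun x hx => Real.rpow_pos_of_pos (norm_pos_iff.2 hx) p)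
    (a := (1 / 2) ^ p) (b := 1) (by positivity) fun x hx => ⟨?_, ?_⟩).congr fun x _ => ?_
  · have := hx.1
    gcongr
  · exact Real.rpow_le_one (norm_nonneg _) hx.2 hp.le
  · simp only [Function.comp]
    rw [← Real.rpow_mul (norm_nonneg _), mul_div_cancel₀ _ hp.ne']

/-- The weights have nonnegative exponents, hence are bounded on the annulus. Below the top order,
the Hölder bound comes from the mean value inequality on the unit ball, since the annulus need not
be convex. -/
theorem HolderNormPow.holderSmoothOffZero {n : ℕ} {α p : ℝ} (hα : 0 < α) (hα1 : α ≤ 1)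
    (hn : n + α ≤ p) (h : HolderNormPow E p n α) :
    HolderSmoothOffZero n α fun x : E => ‖x‖ ^ p := by
  obtain ⟨T, hT, C, hC0, hC, hH⟩ := h
  refine ⟨T, hT.hasFTaylorSeriesUpToOn _, fun k hk => ?_⟩
  have hk' : (k : ℝ) ≤ n := by exact_mod_cast hk
  have hb : ∀ x ∈ halfAnnulus E, ‖T x k‖ ≤ C := fun x hx => (hC k hk x).trans
    (mul_le_of_le_one_right hC0 (Real.rpow_le_one (norm_nonneg _) hx.2 (by linarith)))
  rcases hk.eq_or_lt with rfl | hlt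
  · have h2 : (1 : ℝ) ≤ 2 ^ (p - k - α) := Real.one_le_rpow (by norm_num) (by linarith)
    refine ⟨C * 2 ^ (p - k - α), by positivity, fun x hx => (hb x hx).trans
      (le_mul_of_one_le_right hC0 h2), fun x hx y hy => (hH x y).trans ?_⟩
    rw [mul_right_comm]
    have hxy : ‖x‖ + ‖y‖ ≤ 2 := by linarith [hx.2, hy.2]
    gcongr
    linarith
  · refine ⟨C * 2, by positivity, fun x hx => (hb x hx).trans (by linarith), fun x hx y hy => ?_⟩
    refine (hT.norm_sub_le hlt (p := p) (by linarith) hC0 (fun z => ?_) hx.2 hy.2).trans ?_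
    · simpa using hC (k + 1) hlt z
    · rw [Real.one_rpow, mul_one, mul_assoc]
      gcongr
      exact norm_sub_le_two_mul_rpow hx.2 hy.2 hα hα1

theorem PolynomialNormPow.contDiff {m : ℕ} (h : PolynomialNormPow E m) :
    ContDiff ℝ ∞ fun x : E => ‖x‖ ^ m := by
  obtain ⟨B, hB⟩ := h
  simp_rw [← hB]
  exact B.contDiff.comp (contDiff_pi.2 fun _ => contDiff_id)

theorem PolynomialNormPow.exists_bound {m : ℕ} (h : PolynomialNormPow E m) (k : ℕ) :
    ∃ C, 0 ≤ C ∧ ∀ x : E, ‖x‖ ≤ 1 → ‖iteratedFDeriv ℝ k (fun x : E => ‖x‖ ^ m) x‖ ≤ C := by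
  obtain ⟨B, hB⟩ := h
  let δ : E →L[ℝ] (Fin m → E) := ContinuousLinearMap.pi fun _ => ContinuousLinearMap.id ℝ E
  have hBδ : (fun x : E => ‖x‖ ^ m) = B ∘ δ := by
    ext x
    exact (hB x).symm
  have hδ : ∀ x : E, ‖x‖ ≤ 1 → ‖δ x‖ ≤ 1 := fun x hx =>
    (pi_norm_le_iff_of_nonneg zero_le_one).2 fun _ => hx
  refine ⟨Nat.descFactorial m k * ‖B‖ * ∏ _i : Fin k, ‖δ‖, by positivity, fun x hx => ?_⟩
  rw [hBδ, δ.iteratedFDeriv_comp_right (n := ∞) B.contDiff x (by exact_mod_cast le_top)]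
  refine (ContinuousMultilinearMap.norm_compContinuousLinearMap_le _ _).trans ?_
  gcongr
  refine (B.norm_iteratedFDeriv_le k (δ x)).trans ?_
  rw [Fintype.card_fin]
  exact mul_le_of_le_one_right (by positivity) (pow_le_one₀ (norm_nonneg _) (hδ x hx))

theorem PolynomialNormPow.holderSmoothOffZero {m : ℕ} (h : PolynomialNormPow E m) (n : ℕ) {α : ℝ}
    (hα : 0 < α) (hα1 : α ≤ 1) : HolderSmoothOffZero n α fun x : E => ‖x‖ ^ (m : ℝ) := by
  simp_rw [Real.rpow_natCast]
  have hT : HasFTaylorSeriesUpTo (n + 1 : ℕ) (fun x : E => ‖x‖ ^ m)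
      (ftaylorSeries ℝ fun x : E => ‖x‖ ^ m) :=
    (h.contDiff.of_le (by exact_mod_cast le_top)).ftaylorSeries
  refine ⟨_, (hT.of_le (by exact_mod_cast n.le_succ)).hasFTaylorSeriesUpToOn _, fun k hk => ?_⟩
  obtain ⟨C, hC0, hC⟩ := h.exists_bound k
  obtain ⟨C', hC0', hC'⟩ := h.exists_bound (k + 1)
  refine ⟨C + C' * 2, by positivity, fun x hx => (hC x hx.2).trans (by linarith),
    fun x hx y hy => ?_⟩
  refine ((hT.hasFTaylorSeriesUpToOn univ).norm_sub_le (subset_univ (Metric.closedBall 0 1))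
    (convex_closedBall _ _) (by omega) (C := C') (fun z hz => hC' z (by simpa using hz))
    (by simpa using hx.2) (by simpa using hy.2)).trans ?_
  calc C' * ‖x - y‖ ≤ C' * (2 * ‖x - y‖ ^ α) := by
        gcongr
        exact norm_sub_le_two_mul_rpow hx.2 hy.2 hα hα1
    _ ≤ (C + C' * 2) * ‖x - y‖ ^ α := by
        have : 0 ≤ C * ‖x - y‖ ^ α := by positivity
        linarith

theorem PolynomialNormPow.smoothNorm {m : ℕ} (hm : m ≠ 0) (h : PolynomialNormPow E m) :
    SmoothNorm E := by
  intro x hx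
  have hx' : ‖x‖ ≠ 0 := norm_ne_zero_iff.2 hx
  have h1 : ContDiffAt ℝ ∞ (fun x : E => (‖x‖ ^ m) ^ ((m : ℝ)⁻¹)) x :=
    h.contDiff.contDiffAt.rpow_const_of_ne (pow_ne_zero _ hx')
  refine (h1.congr_of_eventuallyEq (.of_forall fun y => ?_)).contDiffWithinAt
  exact (Real.pow_rpow_inv_natCast (norm_nonneg y) hm).symm

theorem HolderSmoothOffZero.uniformlyHSmoothNorm {r : ℝ}
    (h : HolderSmoothOffZero (largestNatBelow r) (r - largestNatBelow r) fun x : E => ‖x‖) :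
    UniformlyHSmoothNorm E r := by
  obtain ⟨T, hT, hb⟩ := h
  obtain ⟨C, hC0, -, hC⟩ := hb _ le_rfl
  have hopen : IsOpen ({0}ᶜ : Set E) := isOpen_compl_singleton
  have hs : ∀ x ∈ Metric.sphere (0 : E) 1, x ∈ halfAnnulus E ∧ x ∈ ({0}ᶜ : Set E) := by
    intro x hx
    have hx : ‖x‖ = 1 := by simpa using hx
    refine ⟨⟨by rw [hx]; norm_num, hx.le⟩, ?_⟩
    rintro rfl
    simp at hx
  refine ⟨hT.contDiffOn, C + 1, by positivity, fun x hx y hy => ?_⟩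
  obtain ⟨hx1, hx0⟩ := hs x hx
  obtain ⟨hy1, hy0⟩ := hs y hy
  rw [← iteratedFDerivWithin_of_isOpen _ hopen hx0, ← iteratedFDerivWithin_of_isOpen _ hopen hy0,
    ← hT.eq_iteratedFDerivWithin_of_uniqueDiffOn le_rfl hopen.uniqueDiffOn hx0,
    ← hT.eq_iteratedFDerivWithin_of_uniqueDiffOn le_rfl hopen.uniqueDiffOn hy0]
  refine (hC x hx1 y hy1).trans ?_
  gcongr
  linarith

end

/-! ### Extension from the annulus by homogeneity, and polynomial norm powers -/

section

variable {E F : Type*} [NormedAddCommGroup E] [NormedSpace ℝ E] [NormedAddCommGroup F]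

theorem continuous_of_weighted_holder {E : Type*} [NormedAddCommGroup E] {g : E → F} {C α β : ℝ}
    (hα : 0 < α) (hβ : 0 ≤ β)
    (h : ∀ x y, ‖g x - g y‖ ≤ C * ‖x - y‖ ^ α * (‖x‖ + ‖y‖) ^ β) : Continuous g := by
  refine continuous_iff_continuousAt.2 fun y => ?_
  have hc : Continuous fun x : E => C * ‖x - y‖ ^ α * (‖x‖ + ‖y‖) ^ β := by
    refine (continuous_const.mul ?_).mul ?_
    · exact (continuous_id.sub continuous_const).norm.rpow_const fun _ => Or.inr hα.le
    · exact (continuous_norm.add continuous_const).rpow_const fun _ => Or.inr hβ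
  have h0 : Tendsto (fun x : E => C * ‖x - y‖ ^ α * (‖x‖ + ‖y‖) ^ β) (nhds y) (nhds 0) := by
    have := hc.tendsto y
    simpa [hα.ne'] using this
  exact tendsto_iff_norm_sub_tendsto_zero.2
    (squeeze_zero (fun _ => norm_nonneg _) (fun x => h x y) h0)

theorem hasFDerivAt_of_weighted_remainder [NormedSpace ℝ F] {g : E → F} {g' : E →L[ℝ] F} {u : E}
    {C β γ : ℝ} (hβ : 0 < β) (hγ : 0 ≤ γ)
    (h : ∀ z, ‖g z - g u - g' (z - u)‖ ≤ C * ‖z - u‖ ^ (1 + β) * (‖u‖ + ‖z‖) ^ γ) :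
    HasFDerivAt g g' u := by
  refine .of_isLittleO ?_
  have hc : Continuous fun z : E => C * ‖z - u‖ ^ β * (‖u‖ + ‖z‖) ^ γ := by
    refine (continuous_const.mul ?_).mul ?_
    · exact (continuous_id.sub continuous_const).norm.rpow_const fun _ => Or.inr hβ.le
    · exact (continuous_const.add continuous_norm).rpow_const fun _ => Or.inr hγ
  have h0 : Tendsto (fun z : E => C * ‖z - u‖ ^ β * (‖u‖ + ‖z‖) ^ γ) (nhds u) (nhds 0) := by
    simpa [hβ.ne'] using hc.tendsto u
  have h1 := ((Asymptotics.isLittleO_one_iff ℝ).2 h0).mul_isBigO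
    (Asymptotics.isBigO_refl (fun z : E => ‖z - u‖) (nhds u))
  simp only [one_mul] at h1
  refine (Asymptotics.IsBigO.of_bound 1 (.of_forall fun z => ?_)).trans_isLittleO h1.of_norm_right
  rw [one_mul]
  refine ((h z).trans (le_of_eq ?_)).trans (Real.le_norm_self _)
  rw [add_comm (1 : ℝ), Real.rpow_add_one' (norm_nonneg _) (by linarith)]
  ring

/-- Both `x ↦ ‖c • x‖ ^ p` and `c ^ p * ‖x‖ ^ p` have explicit Taylor series, which agree by
uniqueness of derivatives on an open set. -/
theorem HasFTaylorSeriesUpToOn.norm_rpow_smul {n : ℕ} {p : ℝ}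
    {T : E → FormalMultilinearSeries ℝ E ℝ}
    (hT : HasFTaylorSeriesUpToOn n (fun x : E => ‖x‖ ^ p) T {0}ᶜ) {k : ℕ} (hk : k ≤ n) {c : ℝ}
    (hc : 0 < c) {x : E} (hx : x ≠ 0) : T (c • x) k = c ^ (p - k) • T x k := by
  have hopen : IsOpen ({0}ᶜ : Set E) := isOpen_compl_singleton
  have h1 := hT.compContinuousLinearMap (c • ContinuousLinearMap.id ℝ E)
  have h2 := hT.continuousLinearMap_comp (c ^ p • ContinuousLinearMap.id ℝ ℝ)
  have hpre : (c • ContinuousLinearMap.id ℝ E) ⁻¹' {0}ᶜ = ({0}ᶜ : Set E) := by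
    ext y
    simp [hc.ne']
  have hfun : (fun x : E => ‖x‖ ^ p) ∘ (c • ContinuousLinearMap.id ℝ E) =
      (c ^ p • ContinuousLinearMap.id ℝ ℝ) ∘ fun x : E => ‖x‖ ^ p := by
    ext y
    simp [norm_smul, abs_of_pos hc, Real.mul_rpow hc.le]
  rw [hpre, hfun] at h1
  have hkn : (k : WithTop ℕ∞) ≤ n := by exact_mod_cast hk
  have h3 := (h1.eq_iteratedFDerivWithin_of_uniqueDiffOn hkn hopen.uniqueDiffOn hx).trans
    (h2.eq_iteratedFDerivWithin_of_uniqueDiffOn hkn hopen.uniqueDiffOn hx).symm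
  ext v
  have h4 := congrArg (fun A => A v) h3
  have h5 : c ^ k * T (c • x) k v = c ^ p * T x k v := by
    have h6 : T (c • x) k (fun i => c • v i) = c ^ k * T (c • x) k v := by
      rw [(T (c • x) k).map_smul_univ (fun _ => c) v]
      simp
    rw [← h6]
    simpa using h4
  have hck : c ^ k ≠ 0 := pow_ne_zero _ hc.ne'
  rw [smul_apply, smul_eq_mul, Real.rpow_sub hc, Real.rpow_natCast]
  field_simp
  linarith

/-- Dividing by the larger of two norms moves comparable points into the annulus; homogeneity of the
derivatives restores the scale and produces the weight. -/
theorem HolderSmoothOffZero.holderNormPow {n : ℕ} {α p : ℝ} (hα : 0 < α) (hα1 : α ≤ 1)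
    (hn : n + α ≤ p) (h : HolderSmoothOffZero n α fun x : E => ‖x‖ ^ p) :
    HolderNormPow E p n α := by
  classical
  obtain ⟨T, hT, hb⟩ := h
  have hp0 : 0 < p := by
    have : (0 : ℝ) ≤ n := n.cast_nonneg
    linarith
  have hmem : ∀ x y : E, ‖x‖ / 2 ≤ ‖y‖ → ‖y‖ ≤ ‖x‖ → x ≠ 0 → ‖x‖⁻¹ • y ∈ halfAnnulus E := by
    intro x y h1 h2 hx
    have hx' : 0 < ‖x‖ := norm_pos_iff.2 hx
    have : ‖(‖x‖⁻¹ • y)‖ = ‖y‖ / ‖x‖ := by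
      rw [norm_smul, norm_inv, norm_norm, inv_mul_eq_div]
    refine ⟨?_, ?_⟩
    · rw [this, le_div_iff₀ hx']
      linarith
    · rw [this, div_le_one hx']
      exact h2
  have hscale : ∀ k ≤ n, ∀ x y : E, x ≠ 0 → y ≠ 0 →
      T y k = ‖x‖ ^ (p - k) • T (‖x‖⁻¹ • y) k := by
    intro k hk x y hx hy
    have hx' : 0 < ‖x‖ := norm_pos_iff.2 hx
    rw [← hT.norm_rpow_smul hk hx' (smul_ne_zero (inv_ne_zero hx'.ne') hy),
      smul_inv_smul₀ hx'.ne']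
  obtain ⟨C, hC0, hC, hH⟩ : ∃ C : ℝ, 0 ≤ C ∧ (∀ k ≤ n, ∀ x ∈ halfAnnulus E, ‖T x k‖ ≤ C) ∧
      ∀ x ∈ halfAnnulus E, ∀ y ∈ halfAnnulus E, ‖T x n - T y n‖ ≤ C * ‖x - y‖ ^ α := by
    choose! C hC0 hC hH using hb
    have hle : ∀ k ≤ n, C k ≤ ∑ j ∈ Finset.range (n + 1), C j := fun k hk =>
      Finset.single_le_sum (f := C) (fun j hj => hC0 j (by simp at hj; omega))
        (by simp; omega)
    refine ⟨∑ j ∈ Finset.range (n + 1), C j,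
      Finset.sum_nonneg fun j hj => hC0 j (by simp at hj; omega),
      fun k hk x hx => (hC k hk x hx).trans (hle k hk), fun x hx y hy => ?_⟩
    refine (hH n le_rfl x hx y hy).trans ?_
    gcongr
    exact hle n le_rfl
  -- The value zero at the origin is forced by the growth bound, as `p - k ≥ α > 0` for `k ≤ n`.
  let U : E → FormalMultilinearSeries ℝ E ℝ := fun x => if x = 0 then 0 else T x
  have hU0 : U 0 = 0 := if_pos rfl
  have hU : ∀ x, x ≠ 0 → U x = T x := fun x hx => if_neg hx
  have hgrowth : ∀ k ≤ n, ∀ x, ‖U x k‖ ≤ C * ‖x‖ ^ (p - k) := by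
    intro k hk x
    rcases eq_or_ne x 0 with rfl | hx
    · rw [hU0]
      simp only [FormalMultilinearSeries.zero_apply, norm_zero]
      positivity
    · rw [hU x hx, hscale k hk x x hx hx, norm_smul, mul_comm,
        Real.norm_of_nonneg (by positivity)]
      gcongr
      exact hC k hk _ (hmem x x (by linarith [norm_nonneg x]) le_rfl hx)
  have hholder : ∀ x y, ‖y‖ ≤ ‖x‖ →
      ‖U x n - U y n‖ ≤ 4 * C * ‖x - y‖ ^ α * (‖x‖ + ‖y‖) ^ (p - n - α) := by
    intro x y hyx
    rcases eq_or_ne x 0 with rfl | hx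
    · have : y = 0 := by simpa using hyx
      subst this
      simp only [sub_self, norm_zero]
      positivity
    have hx' : 0 < ‖x‖ := norm_pos_iff.2 hx
    have hw : ‖x‖ ^ (p - n - α) ≤ (‖x‖ + ‖y‖) ^ (p - n - α) := by
      gcongr
      · linarith
      · linarith [norm_nonneg y]
    have hpow : ‖x‖ ^ (p - n) = ‖x‖ ^ α * ‖x‖ ^ (p - n - α) := by
      rw [← Real.rpow_add hx']
      congr 1
      ring
    -- Far points: the growth bound suffices, since `‖x‖ ≤ 2 * ‖x - y‖`. Near points: both rescale
    -- into the annulus.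
    rcases le_or_gt (‖x‖ / 2) ‖x - y‖ with hfar | hnear
    · calc ‖U x n - U y n‖ ≤ C * ‖x‖ ^ (p - n) + C * ‖x‖ ^ (p - n) := by
            refine (norm_sub_le _ _).trans (add_le_add (hgrowth n le_rfl x)
              ((hgrowth n le_rfl y).trans ?_))
            gcongr
            linarith
        _ = 2 * C * ‖x‖ ^ α * ‖x‖ ^ (p - n - α) := by rw [hpow]; ring
        _ ≤ 2 * C * (2 * ‖x - y‖ ^ α) * (‖x‖ + ‖y‖) ^ (p - n - α) := by
            gcongr
            calc ‖x‖ ^ α ≤ (2 * ‖x - y‖) ^ α := by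
                  gcongr
                  linarith
              _ = 2 ^ α * ‖x - y‖ ^ α := Real.mul_rpow (by norm_num) (norm_nonneg _)
              _ ≤ 2 * ‖x - y‖ ^ α := by
                  gcongr
                  calc (2 : ℝ) ^ α ≤ 2 ^ (1 : ℝ) := by gcongr; norm_num
                    _ = 2 := by simp
        _ = 4 * C * ‖x - y‖ ^ α * (‖x‖ + ‖y‖) ^ (p - n - α) := by ring
    · have hy2 : ‖x‖ / 2 ≤ ‖y‖ := by
        have := norm_sub_norm_le x y
        linarith
      have hy : y ≠ 0 := by
        rintro rfl
        simp at hy2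
        linarith
      have hdiff : U x n - U y n =
          ‖x‖ ^ (p - n) • (T (‖x‖⁻¹ • x) n - T (‖x‖⁻¹ • y) n) := by
        rw [hU x hx, hU y hy, hscale n le_rfl x x hx hx, hscale n le_rfl x y hx hy]
        exact (smul_sub _ _ _).symm
      rw [hdiff, norm_smul, Real.norm_of_nonneg (by positivity)]
      calc ‖x‖ ^ (p - n) * ‖T (‖x‖⁻¹ • x) n - T (‖x‖⁻¹ • y) n‖
          ≤ ‖x‖ ^ (p - n) * (C * ‖‖x‖⁻¹ • x - ‖x‖⁻¹ • y‖ ^ α) := by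
            gcongr
            exact hH _ (hmem x x (by linarith) le_rfl hx) _ (hmem x y hy2 hyx hx)
        _ = C * ‖x - y‖ ^ α * ‖x‖ ^ (p - n - α) := by
            rw [← smul_sub, norm_smul, norm_inv, norm_norm,
              Real.mul_rpow (by positivity) (norm_nonneg _), Real.inv_rpow hx'.le, hpow]
            have : ‖x‖ ^ α ≠ 0 := (Real.rpow_pos_of_pos hx' α).ne'
            field_simp
        _ ≤ 4 * C * ‖x - y‖ ^ α * (‖x‖ + ‖y‖) ^ (p - n - α) := by
            gcongr
            linarith
  have hholder' : ∀ x y, ‖U x n - U y n‖ ≤ 4 * C * ‖x - y‖ ^ α * (‖x‖ + ‖y‖) ^ (p - n - α) := by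
    intro x y
    rcases le_total ‖y‖ ‖x‖ with hxy | hxy
    · exact hholder x y hxy
    · rw [norm_sub_rev, norm_sub_rev x y, add_comm ‖x‖]
      exact hholder y x hxy
  have hderiv : ∀ k : ℕ, k < n → ∀ x, HasFDerivAt (U · k) (U x (k + 1)).curryLeft x := by
    intro k hk x
    have hkn : (k : ℝ) + 1 ≤ n := by exact_mod_cast hk
    rcases eq_or_ne x 0 with rfl | hx
    · rw [hU0]
      -- At the origin the growth bound is the remainder estimate, of order `p - k > 1` because `k +
      -- 1 ≤ n < p`.
      refine hasFDerivAt_of_weighted_remainder (g := fun x => U x k) (C := C)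
        (β := p - k - 1) (γ := 0) (by linarith) le_rfl fun z => ?_
      rw [Real.rpow_zero, mul_one, sub_zero, add_sub_cancel, hU0]
      refine le_trans (le_of_eq ?_) (hgrowth k hk.le z)
      congr 1
      exact (sub_zero _).trans (sub_zero _)
    · have h1 : HasFDerivAt (T · k) (T x (k + 1)).curryLeft x :=
        (hT.fderivWithin k (by exact_mod_cast hk) x hx).hasFDerivAt
          (isOpen_compl_singleton.mem_nhds hx)
      rw [hU x hx]
      refine h1.congr_of_eventuallyEq ?_
      filter_upwards [isOpen_compl_singleton.mem_nhds hx] with y hy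
      rw [hU y hy]
  refine ⟨U, ⟨fun x => ?_, fun k hk x => hderiv k (by exact_mod_cast hk) x, fun k hk => ?_⟩,
    4 * C, by positivity, fun k hk x => (hgrowth k hk x).trans ?_, hholder'⟩
  · rcases eq_or_ne x 0 with rfl | hx
    · rw [hU0, norm_zero, Real.zero_rpow hp0.ne']
      rfl
    · rw [hU x hx]
      exact hT.zero_eq x hx
  · have hk : k ≤ n := by exact_mod_cast hk
    rcases hk.eq_or_lt with rfl | hlt
    · exact continuous_of_weighted_holder hα (by linarith) hholder'
    · exact continuous_iff_continuousAt.2 fun x => (hderiv k hlt x).continuousAt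
  · gcongr
    linarith

theorem polynomialNormPow_real_two : PolynomialNormPow ℝ 2 :=
  ⟨ContinuousMultilinearMap.mkPiAlgebraFin ℝ 2 ℝ, fun x => by simp [sq]⟩

theorem PolynomialNormPow.add {m k : ℕ} (hm : PolynomialNormPow E m)
    (hk : PolynomialNormPow E k) : PolynomialNormPow E (m + k) := by
  obtain ⟨B, hB⟩ := hm
  obtain ⟨B', hB'⟩ := hk
  let M : MultilinearMap ℝ (fun _ : Fin (m + k) => E) ℝ :=
    ((LinearMap.mul' ℝ ℝ).compMultilinearMap
      (B.toMultilinearMap.domCoprod B'.toMultilinearMap)).domDomCongr finSumFinEquiv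
  have hM : ∀ v, M v = B (fun i => v (Fin.castAdd k i)) * B' (fun i => v (Fin.natAdd m i)) := by
    intro v
    simp [M, MultilinearMap.domDomCongr_apply]
  refine ⟨⟨M, ?_⟩, fun x => ?_⟩
  · show Continuous M
    rw [funext hM]
    fun_prop
  · show M _ = _
    rw [hM, hB, hB', pow_add]

theorem PolynomialNormPow.mul {m : ℕ} (hm : PolynomialNormPow E m) {k : ℕ} (hk : k ≠ 0) :
    PolynomialNormPow E (m * k) := by
  induction k, Nat.one_le_iff_ne_zero.2 hk using Nat.le_induction with
  | base => simpa using hm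
  | succ k hk' ih => exact (ih (Nat.one_le_iff_ne_zero.1 hk')).add hm

end

/-! ### Integrating fields of multilinear forms over `Ω` -/

section

variable {Ω : Type*} [MeasurableSpace Ω] {μ : Measure Ω}
variable {E V W : Type*} [NormedAddCommGroup E] [NormedAddCommGroup V] [NormedAddCommGroup W]

theorem aestronglyMeasurable_pi_fin {X : Type*} [TopologicalSpace X] {k : ℕ} {g : Fin k → Ω → X}
    (hg : ∀ i, AEStronglyMeasurable (g i) μ) :
    AEStronglyMeasurable (fun s (i : Fin k) => g i s) μ := by
  induction k with
  | zero =>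
    exact (aestronglyMeasurable_const (b := (Fin.elim0 : Fin 0 → X))).congr
      (.of_forall fun s => Subsingleton.elim _ _)
  | succ k ih =>
    have hc : Continuous fun z : X × (Fin k → X) => (Fin.cons z.1 z.2 : Fin (k + 1) → X) :=
      Continuous.finCons (A := fun _ => X) continuous_fst continuous_snd
    refine (hc.comp_aestronglyMeasurable ((hg 0).prodMk (ih fun i => hg i.succ))).congr
      (.of_forall fun s => ?_)
    exact Fin.cons_self_tail fun i => g i s

theorem Lp.norm_eq_lpNorm {P : ℝ≥0∞} (u : Lp E P μ) : ‖u‖ = lpNorm u P μ := by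
  rw [Lp.norm_def, toReal_eLpNorm (Lp.aestronglyMeasurable u)]

theorem lintegral_enorm_rpow_eq {p : ℝ} (hp : 0 < p) (f : Ω → E) :
    ∫⁻ s, ‖f s‖ₑ ^ p ∂μ = eLpNorm f (ENNReal.ofReal p) μ ^ p := by
  rw [eLpNorm_eq_lintegral_rpow_enorm_toReal (by simpa using hp) ENNReal.ofReal_ne_top,
    ENNReal.toReal_ofReal hp.le, ← ENNReal.rpow_mul, one_div_mul_cancel hp.ne', ENNReal.rpow_one]

/-- Generalised Hölder inequality for the `p`-th powers, with weights `a / p`, `b / p` and `k`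
copies of `1 / p`; `hsum` says that they add up to one. -/
theorem lintegral_weighted_prod_le {p a b : ℝ} (hp : 0 < p) (ha : 0 ≤ a) (hb : 0 ≤ b) {k : ℕ}
    (hsum : a + b + k = p) {v : Ω → V} {w : Ω → W} (hv : AEStronglyMeasurable v μ)
    (hw : AEStronglyMeasurable w μ) {h : Fin k → Ω → E} (hh : ∀ i, AEStronglyMeasurable (h i) μ) :
    ∫⁻ s, ‖v s‖ₑ ^ a * ‖w s‖ₑ ^ b * ∏ i, ‖h i s‖ₑ ∂μ ≤
      eLpNorm v (ENNReal.ofReal p) μ ^ a * eLpNorm w (ENNReal.ofReal p) μ ^ b *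
        ∏ i, eLpNorm (h i) (ENNReal.ofReal p) μ := by
  let f : Fin 2 ⊕ Fin k → Ω → ℝ≥0∞ := Sum.elim
    ![fun s => ‖v s‖ₑ ^ p, fun s => ‖w s‖ₑ ^ p] fun i s => ‖h i s‖ₑ ^ p
  let e : Fin 2 ⊕ Fin k → ℝ := Sum.elim ![a / p, b / p] fun _ => 1 / p
  have key := ENNReal.lintegral_prod_norm_pow_le (μ := μ) Finset.univ (f := f) (p := e) ?_ ?_ ?_
  · simpa only [f, e, Fintype.prod_sum_type, Fin.prod_univ_two, Sum.elim_inl, Sum.elim_inr,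
      Matrix.cons_val_zero, Matrix.cons_val_one, lintegral_enorm_rpow_eq hp, ← ENNReal.rpow_mul,
      mul_div_cancel₀ _ hp.ne', mul_one_div_cancel hp.ne', ENNReal.rpow_one] using key
  · rintro (i | i) -
    · fin_cases i
      · exact hv.enorm.pow_const p
      · exact hw.enorm.pow_const p
    · exact (hh i).enorm.pow_const p
  · simp only [e, Fintype.sum_sum_type, Fin.sum_univ_two, Sum.elim_inl, Sum.elim_inr,
      Matrix.cons_val_zero, Matrix.cons_val_one, Finset.sum_const, Finset.card_univ,
      Fintype.card_fin, nsmul_eq_mul]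
    field_simp
    linarith
  · rintro (i | i) -
    · fin_cases i
      · exact div_nonneg ha hp.le
      · exact div_nonneg hb hp.le
    · exact div_nonneg zero_le_one hp.le

theorem integrable_and_norm_integral_le {p a b : ℝ} (hp : 0 < p) (ha : 0 ≤ a) (hb : 0 ≤ b) {k : ℕ}
    (hsum : a + b + k = p) {v : Ω → V} {w : Ω → W} (hv : MemLp v (ENNReal.ofReal p) μ)
    (hw : MemLp w (ENNReal.ofReal p) μ) {h : Fin k → Ω → E}
    (hh : ∀ i, MemLp (h i) (ENNReal.ofReal p) μ) {f : Ω → ℝ}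
    (hf : AEStronglyMeasurable f μ) {C : ℝ} (hC : 0 ≤ C)
    (hbound : ∀ᵐ s ∂μ, ‖f s‖ ≤ C * ‖v s‖ ^ a * ‖w s‖ ^ b * ∏ i, ‖h i s‖) :
    Integrable f μ ∧ ‖∫ s, f s ∂μ‖ ≤
      C * lpNorm v (ENNReal.ofReal p) μ ^ a * lpNorm w (ENNReal.ofReal p) μ ^ b *
        ∏ i, lpNorm (h i) (ENNReal.ofReal p) μ := by
  set P := ENNReal.ofReal p
  have hv0 : 0 ≤ lpNorm v P μ := lpNorm_nonneg
  have hw0 : 0 ≤ lpNorm w P μ := lpNorm_nonneg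
  have hR : 0 ≤ C * lpNorm v P μ ^ a * lpNorm w P μ ^ b * ∏ i, lpNorm (h i) P μ := by
    exact mul_nonneg (by positivity) (Finset.prod_nonneg fun _ _ => lpNorm_nonneg)
  have hle : ∫⁻ s, ‖f s‖ₑ ∂μ ≤
      ENNReal.ofReal (C * lpNorm v P μ ^ a * lpNorm w P μ ^ b * ∏ i, lpNorm (h i) P μ) := by
    calc ∫⁻ s, ‖f s‖ₑ ∂μ
        ≤ ∫⁻ s, ENNReal.ofReal C * (‖v s‖ₑ ^ a * ‖w s‖ₑ ^ b * ∏ i, ‖h i s‖ₑ) ∂μ := by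
          refine lintegral_mono_ae (hbound.mono fun s hs => ?_)
          rw [← ofReal_norm]
          refine (ENNReal.ofReal_le_ofReal hs).trans (le_of_eq ?_)
          rw [ENNReal.ofReal_mul (by positivity), ENNReal.ofReal_mul (by positivity),
            ENNReal.ofReal_mul hC, ENNReal.ofReal_prod_of_nonneg fun _ _ => norm_nonneg _,
            ← ENNReal.ofReal_rpow_of_nonneg (norm_nonneg _) ha,
            ← ENNReal.ofReal_rpow_of_nonneg (norm_nonneg _) hb]
          simp only [ofReal_norm, mul_assoc]
      _ = ENNReal.ofReal C * ∫⁻ s, ‖v s‖ₑ ^ a * ‖w s‖ₑ ^ b * ∏ i, ‖h i s‖ₑ ∂μ :=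
          lintegral_const_mul' _ _ ENNReal.ofReal_ne_top
      _ ≤ ENNReal.ofReal C * (eLpNorm v P μ ^ a * eLpNorm w P μ ^ b *
            ∏ i, eLpNorm (h i) P μ) := by
          gcongr
          exact lintegral_weighted_prod_le hp ha hb hsum hv.1 hw.1
            fun i => (hh i).1
      _ = _ := by
          rw [ENNReal.ofReal_mul (by positivity), ENNReal.ofReal_mul (by positivity),
            ENNReal.ofReal_mul hC, ENNReal.ofReal_prod_of_nonneg fun _ _ => lpNorm_nonneg,
            ← ENNReal.ofReal_rpow_of_nonneg hv0 ha, ← ENNReal.ofReal_rpow_of_nonneg hw0 hb,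
            ofReal_lpNorm hv, ofReal_lpNorm hw]
          simp only [ofReal_lpNorm (hh _), mul_assoc]
  refine ⟨⟨hf, hle.trans_lt ENNReal.ofReal_lt_top⟩, ?_⟩
  refine (ENNReal.ofReal_le_ofReal_iff hR).1 ?_
  rw [ofReal_norm]
  exact (enorm_integral_le_lintegral_enorm f).trans hle

theorem Lp.norm_rpow_eq_integral {p : ℝ} (hp : 0 < p) (u : Lp E (ENNReal.ofReal p) μ) :
    ‖u‖ ^ p = ∫ s, ‖u s‖ ^ p ∂μ := by
  rw [Lp.norm_eq_lpNorm, lpNorm_eq_integral_norm_rpow_toReal (by simpa using hp)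
    ENNReal.ofReal_ne_top (Lp.aestronglyMeasurable u), ENNReal.toReal_ofReal hp.le]
  exact Real.rpow_inv_rpow (integral_nonneg fun s => by positivity) hp.ne'

variable [NormedSpace ℝ E]

theorem ContinuousMultilinearMap.aestronglyMeasurable_apply {k : ℕ} {A : Ω → E [×k]→L[ℝ] ℝ}
    (hA : AEStronglyMeasurable A μ) {h : Fin k → Ω → E}
    (hh : ∀ i, AEStronglyMeasurable (h i) μ) :
    AEStronglyMeasurable (fun s => A s fun i => h i s) μ :=
  (continuous_eval (F := E [×k]→L[ℝ] ℝ)).comp_aestronglyMeasurable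
    (hA.prodMk (aestronglyMeasurable_pi_fin hh))

theorem ContinuousMultilinearMap.integrable_apply_and_norm_integral_le {p a b : ℝ} (hp : 0 < p)
    (ha : 0 ≤ a) (hb : 0 ≤ b) {k : ℕ} (hsum : a + b + k = p) {v : Ω → V} {w : Ω → W}
    (hv : MemLp v (ENNReal.ofReal p) μ) (hw : MemLp w (ENNReal.ofReal p) μ)
    {A : Ω → E [×k]→L[ℝ] ℝ} (hA : AEStronglyMeasurable A μ) {C : ℝ} (hC : 0 ≤ C)
    (hbound : ∀ᵐ s ∂μ, ‖A s‖ ≤ C * ‖v s‖ ^ a * ‖w s‖ ^ b)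
    (h : Fin k → Lp E (ENNReal.ofReal p) μ) :
    Integrable (fun s => A s fun i => h i s) μ ∧ ‖∫ s, A s (fun i => h i s) ∂μ‖ ≤
      C * lpNorm v (ENNReal.ofReal p) μ ^ a * lpNorm w (ENNReal.ofReal p) μ ^ b *
        ∏ i, ‖h i‖ := by
  simp only [Lp.norm_eq_lpNorm]
  refine integrable_and_norm_integral_le hp ha hb hsum hv hw (fun i => Lp.memLp (h i))
    (aestronglyMeasurable_apply hA fun i => Lp.aestronglyMeasurable (h i)) hC
    (hbound.mono fun s hs => ((A s).le_opNorm _).trans ?_)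
  gcongr

/-- Integrating a field of `k`-linear forms with suitable growth gives a `k`-linear form on the
Lebesgue–Bochner space. -/
theorem exists_integral_form {p : ℝ} [Fact (1 ≤ ENNReal.ofReal p)] (hp : 0 < p) {k : ℕ}
    (hk : (k : ℝ) ≤ p) {A : Ω → E [×k]→L[ℝ] ℝ} (hA : AEStronglyMeasurable A μ) {v : Ω → V}
    (hv : MemLp v (ENNReal.ofReal p) μ) {C : ℝ} (hC : 0 ≤ C)
    (hbound : ∀ᵐ s ∂μ, ‖A s‖ ≤ C * ‖v s‖ ^ (p - k)) :
    ∃ L : Lp E (ENNReal.ofReal p) μ [×k]→L[ℝ] ℝ,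
      ∀ h, L h = ∫ s, A s (fun i => h i s) ∂μ := by
  have key := ContinuousMultilinearMap.integrable_apply_and_norm_integral_le hp
    (sub_nonneg.2 hk) le_rfl (by ring) hv hv hA hC (E := E) (by simpa using hbound)
  have hupd : ∀ [DecidableEq (Fin k)] (h : Fin k → Lp E (ENNReal.ofReal p) μ) (i : Fin k)
      (x : Lp E (ENNReal.ofReal p) μ) (s : Ω),
      (fun j => (Function.update h i x j : Ω → E) s) =
        Function.update (fun j => (h j : Ω → E) s) i (x s) := by
    intro _ h i x s
    ext j
    rcases eq_or_ne j i with rfl | hj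
    · simp
    · simp [hj]
  refine ⟨MultilinearMap.mkContinuous ⟨fun h => ∫ s, A s (fun i => h i s) ∂μ, ?_, ?_⟩
    (C * lpNorm v (ENNReal.ofReal p) μ ^ (p - k) * lpNorm v (ENNReal.ofReal p) μ ^ (0 : ℝ))
    fun h => (key h).2, fun h => rfl⟩
  · intro _ h i x y
    rw [← integral_add (key _).1 (key _).1]
    refine integral_congr_ae ?_
    filter_upwards [Lp.coeFn_add x y] with s hs
    simp only [hupd, hs, Pi.add_apply, ContinuousMultilinearMap.map_update_add]
  · intro _ h i c x
    rw [smul_eq_mul, ← integral_const_mul]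
    refine integral_congr_ae ?_
    filter_upwards [Lp.coeFn_smul c x] with s hs
    simp only [hupd, hs, Pi.smul_apply, ContinuousMultilinearMap.map_update_smul, smul_eq_mul]

theorem norm_integral_form_le {p : ℝ} [Fact (1 ≤ ENNReal.ofReal p)] {a b : ℝ} (hp : 0 < p)
    (ha : 0 ≤ a) (hb : 0 ≤ b) {k : ℕ} (hsum : a + b + k = p) {v : Ω → V} {w : Ω → W}
    (hv : MemLp v (ENNReal.ofReal p) μ) (hw : MemLp w (ENNReal.ofReal p) μ)
    {A : Ω → E [×k]→L[ℝ] ℝ} (hA : AEStronglyMeasurable A μ) {C : ℝ} (hC : 0 ≤ C)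
    (hbound : ∀ᵐ s ∂μ, ‖A s‖ ≤ C * ‖v s‖ ^ a * ‖w s‖ ^ b)
    {L : Lp E (ENNReal.ofReal p) μ [×k]→L[ℝ] ℝ}
    (hL : ∀ h, L h = ∫ s, A s (fun i => h i s) ∂μ) :
    ‖L‖ ≤ C * lpNorm v (ENNReal.ofReal p) μ ^ a * lpNorm w (ENNReal.ofReal p) μ ^ b := by
  refine L.opNorm_le_bound ?_ fun h => ?_
  · have := lpNorm_nonneg (f := v) (p := ENNReal.ofReal p) (μ := μ)
    have := lpNorm_nonneg (f := w) (p := ENNReal.ofReal p) (μ := μ)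
    positivity
  · rw [hL]
    exact (ContinuousMultilinearMap.integrable_apply_and_norm_integral_le hp ha hb hsum hv hw hA hC
      hbound h).2

/-- Integrating the constant field `B` gives an `m`-linear form whose diagonal is `∫ ‖u s‖ ^ m`. -/
theorem PolynomialNormPow.lp {m : ℕ} (hm : m ≠ 0) (hE : PolynomialNormPow E m)
    [Fact (1 ≤ ENNReal.ofReal m)] : PolynomialNormPow (Lp E (ENNReal.ofReal m) μ) m := by
  obtain ⟨B, hB⟩ := hE
  have hm' : (0 : ℝ) < m := by positivity
  obtain ⟨L, hL⟩ := exists_integral_form (μ := μ) (E := E) (A := fun _ => B) (V := ℝ) (v := 0)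
    (k := m) hm' le_rfl aestronglyMeasurable_const MemLp.zero (norm_nonneg B) (by simp)
  refine ⟨L, fun u => ?_⟩
  rw [hL]
  have := Lp.norm_rpow_eq_integral hm' u
  simp only [Real.rpow_natCast] at this
  rw [this]
  exact integral_congr_ae (.of_forall fun s => hB (u s))

end

/-! ### From `E` to `L_p(E)` -/

section

variable {Ω : Type*} [MeasurableSpace Ω] {μ : Measure Ω}
variable {E : Type*} [NormedAddCommGroup E] [NormedSpace ℝ E]

/-- Taylor remainder estimate from a weighted Hölder bound on the next term of the series. -/
theorem HasFTaylorSeriesUpTo.norm_remainder_le {n : ℕ} {f : E → ℝ}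
    {T : E → FormalMultilinearSeries ℝ E ℝ} (hT : HasFTaylorSeriesUpTo n f T) {k : ℕ} (hk : k < n)
    {C β γ : ℝ} (hC : 0 ≤ C) (hβ : 0 < β) (hγ : 0 ≤ γ)
    (h : ∀ x y, ‖T x (k + 1) - T y (k + 1)‖ ≤ C * ‖x - y‖ ^ β * (‖x‖ + ‖y‖) ^ γ) (x z : E) :
    ‖T z k - T x k - (T x (k + 1)).curryLeft (z - x)‖ ≤
      C * 2 ^ γ * ‖z - x‖ ^ (1 + β) * (‖x‖ + ‖z‖) ^ γ := by
  have hseg : ∀ y ∈ segment ℝ x z,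
      ‖(T y (k + 1)).curryLeft - (T x (k + 1)).curryLeft‖ ≤
        C * ‖z - x‖ ^ β * (2 * (‖x‖ + ‖z‖)) ^ γ := by
    intro y hy
    have h1 : ‖y - x‖ ≤ ‖z - x‖ := norm_sub_le_of_mem_segment hy
    have h2 : ‖y‖ ≤ ‖x‖ + ‖z‖ := by
      have hconv : y ∈ Metric.closedBall (0 : E) (‖x‖ + ‖z‖) :=
        (convex_closedBall _ _).segment_subset (by simp) (by simp) hy
      simpa using hconv
    have h3 : ‖(T y (k + 1)).curryLeft - (T x (k + 1)).curryLeft‖ =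
        ‖T y (k + 1) - T x (k + 1)‖ :=
      (continuousMultilinearCurryLeftEquiv ℝ (fun _ : Fin (k + 1) => E) ℝ).norm_map
        (T y (k + 1) - T x (k + 1))
    rw [h3]
    refine (h y x).trans ?_
    have h4 : ‖y‖ + ‖x‖ ≤ 2 * (‖x‖ + ‖z‖) := by linarith [norm_nonneg z]
    gcongr
  have hmv := (convex_segment x z).norm_image_sub_le_of_norm_hasFDerivWithin_le'
    (f := fun y => T y k) (fun y _ => (hT.fderiv k (by exact_mod_cast hk) y).hasFDerivWithinAt)
    hseg (left_mem_segment ℝ x z) (right_mem_segment ℝ x z)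
  refine hmv.trans (le_of_eq ?_)
  rw [Real.mul_rpow (by norm_num) (by positivity),
    add_comm (1 : ℝ), Real.rpow_add_one' (norm_nonneg _) (by linarith)]
  ring

theorem lpNorm_norm_add_norm_le {E : Type*} [NormedAddCommGroup E] {P : ℝ≥0∞}
    [Fact (1 ≤ P)] (u v : Lp E P μ) :
    lpNorm (fun s => ‖u s‖ + ‖v s‖) P μ ≤ ‖u‖ + ‖v‖ := by
  refine (lpNorm_add_le (f := fun s => ‖u s‖) (g := fun s => ‖v s‖) (Lp.memLp u).norm
    Fact.out).trans (le_of_eq ?_)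
  rw [lpNorm_norm (Lp.aestronglyMeasurable u), lpNorm_norm (Lp.aestronglyMeasurable v),
    Lp.norm_eq_lpNorm, Lp.norm_eq_lpNorm]

/-- A form on the Lebesgue–Bochner space with a density controlled pointwise by two functions. -/
theorem norm_integral_form_le_of_pair {p : ℝ} [Fact (1 ≤ ENNReal.ofReal p)] {a b : ℝ} (hp : 0 < p)
    (ha : 0 ≤ a) (hb : 0 ≤ b) {k : ℕ} (hsum : a + b + k = p) (u v : Lp E (ENNReal.ofReal p) μ)
    {A : Ω → E [×k]→L[ℝ] ℝ} (hA : AEStronglyMeasurable A μ) {C : ℝ} (hC : 0 ≤ C)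
    (hbound : ∀ s, ‖A s‖ ≤ C * ‖v s - u s‖ ^ a * (‖u s‖ + ‖v s‖) ^ b)
    {L : Lp E (ENNReal.ofReal p) μ [×k]→L[ℝ] ℝ}
    (hL : ∀ h, L h = ∫ s, A s (fun i => h i s) ∂μ) :
    ‖L‖ ≤ C * ‖v - u‖ ^ a * (‖u‖ + ‖v‖) ^ b := by
  refine (norm_integral_form_le hp ha hb hsum (Lp.memLp (v - u))
    (w := fun s => ‖u s‖ + ‖v s‖) ((Lp.memLp u).norm.add (Lp.memLp v).norm) hA hC ?_ hL).trans ?_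
  · filter_upwards [Lp.coeFn_sub v u] with s hs
    rw [hs, Real.norm_of_nonneg (by positivity : 0 ≤ ‖u s‖ + ‖v s‖)]
    exact hbound s
  · rw [Lp.norm_eq_lpNorm (v - u)]
    have := lpNorm_nonneg (f := (v - u : Lp E (ENNReal.ofReal p) μ)) (p := ENNReal.ofReal p)
      (μ := μ)
    have := lpNorm_nonneg (f := fun s => ‖u s‖ + ‖v s‖) (p := ENNReal.ofReal p) (μ := μ)
    gcongr
    exact lpNorm_norm_add_norm_le u v

/-- The derivatives are obtained by integrating the pointwise ones. Differentiability is proved by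
integrating the pointwise Taylor remainder, which avoids any dominated convergence argument. -/
theorem HolderNormPow.lp {p α : ℝ} {n : ℕ} [Fact (1 ≤ ENNReal.ofReal p)] (hα : 0 < α)
    (hn : n + α ≤ p) (hE : HolderNormPow E p n α) :
    HolderNormPow (Lp E (ENNReal.ofReal p) μ) p n α := by
  obtain ⟨T, hT, C, hC0, hC, hH⟩ := hE
  have hp : 0 < p := by
    have : (0 : ℝ) ≤ n := n.cast_nonneg
    linarith
  -- The balance `β + γ + k = p` is what Hölder's inequality needs. Below the top order `β = 1`,
  -- from the bound on the next derivative.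
  have hmod : ∀ k ≤ n, ∃ β γ D : ℝ, 0 < β ∧ 0 ≤ γ ∧ 0 ≤ D ∧ β + γ + k = p ∧
      ∀ x y, ‖T x k - T y k‖ ≤ D * ‖x - y‖ ^ β * (‖x‖ + ‖y‖) ^ γ := by
    intro k hk
    rcases hk.eq_or_lt with rfl | hlt
    · exact ⟨α, p - k - α, C, hα, by linarith, hC0, by ring, hH⟩
    · have hk1 : (k : ℝ) + 1 ≤ n := by exact_mod_cast hlt
      refine ⟨1, p - (k + 1), C, one_pos, by linarith, hC0, by ring, fun x y => ?_⟩
      rw [Real.rpow_one, mul_right_comm]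
      exact hT.norm_sub_le hlt (by linarith) hC0 (fun z => by simpa using hC (k + 1) hlt z)
        (by linarith [norm_nonneg y]) (by linarith [norm_nonneg x])
  have hmeas : ∀ k ≤ n, ∀ u : Lp E (ENNReal.ofReal p) μ,
      AEStronglyMeasurable (fun s => T (u s) k) μ := fun k hk u =>
    (hT.cont k (by exact_mod_cast hk)).comp_aestronglyMeasurable (Lp.aestronglyMeasurable u)
  have hkp : ∀ k ≤ n, (k : ℝ) ≤ p := fun k hk => by
    have : (k : ℝ) ≤ n := by exact_mod_cast hk
    linarith
  have hbd : ∀ k ≤ n, ∀ u : Lp E (ENNReal.ofReal p) μ, ∀ᵐ s ∂μ,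
      ‖T (u s) k‖ ≤ C * ‖u s‖ ^ (p - k) * ‖u s‖ ^ (0 : ℝ) := fun k hk u =>
    .of_forall fun s => by simpa using hC k hk (u s)
  have hint : ∀ k ≤ n, ∀ (u : Lp E (ENNReal.ofReal p) μ) (h : Fin k → Lp E (ENNReal.ofReal p) μ),
      Integrable (fun s => T (u s) k fun i => h i s) μ := fun k hk u h =>
    (ContinuousMultilinearMap.integrable_apply_and_norm_integral_le hp (sub_nonneg.2 (hkp k hk))
      le_rfl (by ring) (Lp.memLp u) (Lp.memLp u) (hmeas k hk u) hC0 (hbd k hk u) h).1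
  have hform : ∀ (k : ℕ) (u : Lp E (ENNReal.ofReal p) μ),
      ∃ L : Lp E (ENNReal.ofReal p) μ [×k]→L[ℝ] ℝ, k ≤ n →
        ∀ h, L h = ∫ s, T (u s) k (fun i => h i s) ∂μ := by
    intro k u
    by_cases hk : k ≤ n
    · obtain ⟨L, hL⟩ := exists_integral_form hp (hkp k hk) (hmeas k hk u) (Lp.memLp u) hC0
        (.of_forall fun s => hC k hk (u s))
      exact ⟨L, fun _ => hL⟩
    · exact ⟨0, fun h => absurd h hk⟩
  choose L hL using hform
  have hdiff : ∀ k ≤ n, ∀ {β γ D : ℝ}, 0 < β → 0 ≤ γ → 0 ≤ D → β + γ + k = p →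
      (∀ x y, ‖T x k - T y k‖ ≤ D * ‖x - y‖ ^ β * (‖x‖ + ‖y‖) ^ γ) → ∀ u v,
      ‖L k u - L k v‖ ≤ D * ‖u - v‖ ^ β * (‖u‖ + ‖v‖) ^ γ := by
    intro k hk β γ D hβ hγ hD hsum hTk u v
    rw [add_comm ‖u‖]
    refine norm_integral_form_le_of_pair hp hβ.le hγ hsum v u
      (A := fun s => T (u s) k - T (v s) k) ((hmeas k hk u).sub (hmeas k hk v)) hD
      (fun s => ?_) fun h => ?_
    · rw [add_comm ‖v s‖]
      exact hTk _ _
    · rw [sub_apply, hL k u hk, hL k v hk, ← integral_sub (hint k hk u h) (hint k hk v h)]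
      rfl
  have hderiv : ∀ k < n, ∀ u, HasFDerivAt (L k ·) (L (k + 1) u).curryLeft u := by
    intro k hk u
    obtain ⟨β, γ, D, hβ, hγ, hD, hsum, hTk⟩ := hmod (k + 1) hk
    push_cast at hsum
    -- The remainder has exponents `1 + β` and `γ` and is `k`-linear, so its degrees again sum to
    -- `p`; the factor `2 ^ γ` comes from `HasFTaylorSeriesUpTo.norm_remainder_le`.
    refine hasFDerivAt_of_weighted_remainder (C := D * 2 ^ γ) hβ hγ fun z => ?_
    have hcurry : ∀ h : Fin k → Lp E (ENNReal.ofReal p) μ, (fun s => T (u s) (k + 1)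
        fun i => (Fin.cons (z - u) h : Fin (k + 1) → Lp E (ENNReal.ofReal p) μ) i s) =ᵐ[μ]
        fun s => (T (u s) (k + 1)).curryLeft (z s - u s) fun i => h i s := by
      intro h
      filter_upwards [Lp.coeFn_sub z u] with s hs
      rw [ContinuousMultilinearMap.curryLeft_apply]
      congr 1
      ext i
      refine Fin.cases ?_ (fun j => ?_) i
      · exact hs
      · rfl
    refine norm_integral_form_le_of_pair hp (by linarith) hγ (by linarith) u z
      (A := fun s => T (z s) k - T (u s) k - (T (u s) (k + 1)).curryLeft (z s - u s))
      ?_ (by positivity) (fun s => ?_) fun h => ?_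
    · refine ((hmeas k hk.le z).sub (hmeas k hk.le u)).sub ?_
      have hc : Continuous fun w : (E [×(k + 1)]→L[ℝ] ℝ) × E => w.1.curryLeft w.2 :=
        ((continuousMultilinearCurryLeftEquiv ℝ (fun _ : Fin (k + 1) => E) ℝ).continuous.comp
          continuous_fst).clm_apply continuous_snd
      exact hc.comp_aestronglyMeasurable ((hmeas (k + 1) hk u).prodMk
        ((Lp.aestronglyMeasurable z).sub (Lp.aestronglyMeasurable u)))
    · exact hT.norm_remainder_le hk hD hβ hγ hTk _ _
    · have hi := hint (k + 1) hk u (Fin.cons (z - u) h)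
      have hi' : Integrable (fun s => T (z s) k (fun i => h i s) - T (u s) k fun i => h i s) μ :=
        (hint k hk.le z h).sub (hint k hk.le u h)
      rw [sub_apply, sub_apply, ContinuousMultilinearMap.curryLeft_apply, hL k z hk.le,
        hL k u hk.le, hL (k + 1) u hk, ← integral_sub (hint k hk.le z h) (hint k hk.le u h),
        integral_congr_ae (hcurry h), ← integral_sub hi' (hi.congr (hcurry h))]
      rfl
  refine ⟨fun u k => L k u, ⟨fun u => ?_, fun k hk u => hderiv k (by exact_mod_cast hk) u,
    fun k hk => ?_⟩, C, hC0, fun k hk u => ?_, fun u v => ?_⟩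
  · show L 0 u 0 = ‖u‖ ^ p
    rw [hL 0 u (Nat.zero_le _), Lp.norm_rpow_eq_integral hp]
    refine integral_congr_ae (.of_forall fun s => ?_)
    exact (congrArg (T (u s) 0) (Subsingleton.elim _ _)).trans (hT.zero_eq (u s))
  · have hk : k ≤ n := by exact_mod_cast hk
    obtain ⟨β, γ, D, hβ, hγ, hD, hsum, hTk⟩ := hmod k hk
    exact continuous_of_weighted_holder hβ hγ (hdiff k hk hβ hγ hD hsum hTk)
  · have := norm_integral_form_le hp (sub_nonneg.2 (hkp k hk)) le_rfl (by ring) (Lp.memLp u)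
      (Lp.memLp u) (hmeas k hk u) hC0 (hbd k hk u) (hL k u hk)
    simpa [Lp.norm_eq_lpNorm] using this
  · exact hdiff n le_rfl hα (by linarith) hC0 (by ring) hH u v

theorem PolynomialNormPow.holderNormPow {m n : ℕ} {p α : ℝ} (hm : m ≠ 0) (hα : 0 < α) (hα1 : α ≤ 1)
    (hn : n + α ≤ p) (h : PolynomialNormPow E m) : HolderNormPow E p n α :=
  ((h.holderSmoothOffZero n hα hα1).norm_rpow (by positivity) p).holderNormPow hα hα1 hn

theorem HolderNormPow.of_exponent {n : ℕ} {p q α : ℝ} (hα : 0 < α) (hα1 : α ≤ 1)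
    (hq : n + α ≤ q) (hp : n + α ≤ p) (h : HolderNormPow E q n α) : HolderNormPow E p n α :=
  ((h.holderSmoothOffZero hα hα1 hq).norm_rpow
    (by have : (0 : ℝ) ≤ n := n.cast_nonneg
        linarith) p).holderNormPow hα hα1 hp

theorem HolderNormPow.uniformlyHSmoothNorm {p r : ℝ}
    (hα : 0 < r - largestNatBelow r) (hα1 : r - largestNatBelow r ≤ 1) (hr : r ≤ p)
    (h : HolderNormPow E p (largestNatBelow r) (r - largestNatBelow r)) :
    UniformlyHSmoothNorm E r := by
  have h0 : (0 : ℝ) ≤ largestNatBelow r := Nat.cast_nonneg _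
  refine HolderSmoothOffZero.uniformlyHSmoothNorm ?_
  simpa using (h.holderSmoothOffZero hα hα1 (by linarith)).norm_rpow (by linarith) 1

theorem largestNatBelow_bounds {r : ℝ} (hr : 0 < r) :
    0 < r - largestNatBelow r ∧ r - largestNatBelow r ≤ 1 := by
  have h := isGreatest_largestNatBelow hr
  have h1 : (largestNatBelow r : ℝ) < r := by simpa using h.1
  refine ⟨sub_pos.2 h1, ?_⟩
  by_contra! h2
  have h3 : ((largestNatBelow r : ℤ) + 1) ∈ {m : ℤ | (m : ℝ) < r} := by
    simp only [mem_ofPred_eq]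
    push_cast
    linarith
  have := h.2 h3
  omega

end

/-! ### Assembly for `L_p(L_q)` -/

theorem corollary2p3
    {Ω : Type*} [MeasurableSpace Ω] (μ : Measure Ω)
    {Ω' : Type*} [MeasurableSpace Ω'] (ν : Measure Ω')
    (p q r : ℝ) (hp : 1 < p) (hq : 1 < q) (hr : r = min p q)
    [Fact (1 ≤ ENNReal.ofReal p)] [Fact (1 ≤ ENNReal.ofReal q)] :
    (¬ IsEvenInteger r ∨ (r = p ∧ IsEvenInteger r) →
      UniformlyHSmoothNorm (Lp (Lp ℝ (ENNReal.ofReal q) ν) (ENNReal.ofReal p) μ) r) ∧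
    (IsEvenInteger r ∧ r = q →
      UniformlyHSmoothNorm (Lp (Lp ℝ (ENNReal.ofReal q) ν) (ENNReal.ofReal p) μ) p ∧
      ((∃ k : ℤ, p = (k : ℝ) * q) →
        SmoothNorm (Lp (Lp ℝ (ENNReal.ofReal q) ν) (ENNReal.ofReal p) μ))) := by
  have hrp : r ≤ p := hr ▸ min_le_left p q
  have hrq : r ≤ q := hr ▸ min_le_right p q
  have hr1 : 1 < r := hr ▸ lt_min hp hq
  constructor
  · intro _
    obtain ⟨hα, hα1⟩ := largestNatBelow_bounds (r := r) (by linarith)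
    have hsum : largestNatBelow r + (r - largestNatBelow r) = r := by ring
    have hℝ : HolderNormPow ℝ q (largestNatBelow r) (r - largestNatBelow r) :=
      polynomialNormPow_real_two.holderNormPow two_ne_zero hα hα1 (by linarith)
    have hLq : HolderNormPow (Lp ℝ (ENNReal.ofReal q) ν) q _ _ :=
      hℝ.lp hα (by linarith)
    -- The smoothness `r` is at most both `q` and `p`, so the exponent can be switched between the
    -- two integrations.
    have hX : HolderNormPow (Lp (Lp ℝ (ENNReal.ofReal q) ν) (ENNReal.ofReal p) μ) p _ _ :=
      (hLq.of_exponent hα hα1 (by linarith) (by linarith)).lp hα (by linarith)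
    exact hX.uniformlyHSmoothNorm hα hα1 hrp
  · rintro ⟨⟨j, hj, hjr⟩, rfl⟩
    obtain ⟨i, rfl⟩ := hj
    have hi : 0 < i := by
      have : (0 : ℝ) < ((i + i : ℤ) : ℝ) := by linarith
      have : 0 < i + i := by exact_mod_cast this
      omega
    lift i to ℕ using hi.le
    have hi0 : i ≠ 0 := by omega
    obtain rfl : r = ((2 * i : ℕ) : ℝ) := by
      rw [hjr]
      push_cast
      ring
    have hLq : PolynomialNormPow (Lp ℝ (ENNReal.ofReal ((2 * i : ℕ) : ℝ)) ν) (2 * i) :=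
      (polynomialNormPow_real_two.mul hi0).lp (by omega)
    refine ⟨?_, ?_⟩
    · obtain ⟨hα, hα1⟩ := largestNatBelow_bounds (r := p) (by linarith)
      have hsum : largestNatBelow p + (p - largestNatBelow p) = p := by ring
      -- The polynomial allows every order, so smoothness `p` is available here although `p` may
      -- exceed `q`.
      have hLp : HolderNormPow (Lp ℝ (ENNReal.ofReal ((2 * i : ℕ) : ℝ)) ν) p
          (largestNatBelow p) (p - largestNatBelow p) :=
        hLq.holderNormPow (by omega) hα hα1 hsum.le
      exact (hLp.lp hα hsum.le).uniformlyHSmoothNorm hα hα1 le_rfl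
    · rintro ⟨k, hk⟩
      have hk0 : 0 < k := by
        have h2 : (0 : ℝ) < k := by
          by_contra! h
          have := mul_nonpos_of_nonpos_of_nonneg h (Nat.cast_nonneg (α := ℝ) (2 * i))
          linarith
        exact_mod_cast h2
      lift k to ℕ using hk0.le
      have hk0 : k ≠ 0 := by omega
      obtain rfl : p = ((2 * i * k : ℕ) : ℝ) := by
        rw [hk]
        push_cast
        ring
      have hm : 2 * i * k ≠ 0 := by positivity
      -- The `k`-th power of the polynomial on `L_q` has degree `p` and integrates to one on
      -- `L_p(L_q)`; its `p`-th root is smooth off the origin.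
      exact ((hLq.mul hk0).lp hm).smoothNorm hm
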